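/- Let $p$ be a prime and let $(\Omega,|\cdot|)$ be a field of characteristic $0$ with a non-archimedean absolute value normalised by $|p|=1/p$. For $\rho>0$ let $\mathcal A_\rho$ be the ring of power series $f=\sum_{s\ge 0}a_sT^s\in\Omega[[T]]$ with radius of convergence at least $\rho$, i.e. $|a_s|r^s\to 0$ for all $0<r<\rho$ (for a disk with centre $a$, $T=z-a$), and let $\mathcal A'_\rho=\mathrm{Frac}(\mathcal A_\rho)$, with the derivation $D=d/dT$. For $0<R<\rho$ put $|f|(R)=\sup_s|a_s|R^s$ for $f\in\mathcal A_\rho$ (if $\Omega$ is complete with infinite residue field and $R\in|\Omega^\times|$, this is $\sup_{|T|=R}|f(T)|$), extend it to $\mathcal A'_\rho$ by $|f/g|(R)=|f|(R)/|g|(R)$, and put $\|h\|_\rho=\limsup_{R\to\rho^-}|h|(R)\in[0,\infty]$; write $\|\cdot\|_0$ for $\|\cdot\|_1$. The norm of a matrix is the maximum of the norms of its entries. For integers $s,m\ge 0$ let $$\{s,m\}_p=\max\Big\{\frac1{|\lambda_1\cdots\lambda_k|_p}\;:\;0\le k\le m,\ 1\le\lambda_1<\dots<\lambda_k\le s\Big\},$$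 the empty product being $1$; if $m\le s$ it suffices to take $k=m$. 1. (Dwork–Robba) Let $u_1,\dots,u_n\in\mathcal A'_1$ have invertible Wronskian matrix $W=(D^iu_j)_{0\le i<n,\,1\le j\le n}$. For every $s\ge 0$ there is a unique row $(G_{s,0},\dots,G_{s,n-1})\in(\mathcal A'_1)^n$ with $\frac{D^s}{s!}(u_1,\dots,u_n)=(G_{s,0},\dots,G_{s,n-1})\,W$, and $\|G_{s,j}\|_0\le\{s,n-1\}_p$ for all $0\le j\le n-1$. 2. (Systems on the unit disk) Let $A\in M_n(\mathcal A'_1)$ and let $A_s$ be the matrices with $\frac{D^s}{s!}y=A_sy$ whenever $Dy=Ay$, that is $A_0=I$ and $(s+1)A_{s+1}=DA_s+A_sA$. If there is $Y\in GL_n(\mathcal A'_1)$ with $DY=AY$ (so that $D^sY/s!=A_sY$ for all $s$), then for all $s\ge 0$ $$\|A_s\|_0\le\{s,n-1\}_p\,\sup_{0\le i\le n-1}\|i!\,A_i\|_0.$$ 3. (Systems on a disk of radius $\rho$) Let $\rho>0$, let $A\in M_n(\mathcal A'_\rho)$, define $A_s$ as in 2, and suppose that there is $Y\in GL_n(\mathcal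 A'_\rho)$ with $DY=AY$. Then for all $s\ge 0$ $$\|A_s\|_\rho\le\rho^{-s}\,\{s,n-1\}_p\,\sup_{0\le i\le n-1}\rho^i\,\|i!\,A_i\|_\rho .$$ -/

import Mathlib

open Filter Topology PowerSeries
open scoped NNReal ENNReal

namespace DworkRobba
noncomputable section

/-! ### Extension of a derivation to the fraction field -/

section FractionDerivation
variable {R A K : Type*} [CommRing R] [CommRing A] [Field K] [Algebra R A] [Algebra A K]
  [IsFractionRing A K]

/-- `(d f * g - f * d g) / g ^ 2`, where `x = f / g`. -/
def quotientRule (d : Derivation R A A) (x : K) : K :=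
  (algebraMap A K (d (IsLocalization.sec (nonZeroDivisors A) x).1) *
      algebraMap A K (IsLocalization.sec (nonZeroDivisors A) x).2 -
    algebraMap A K (IsLocalization.sec (nonZeroDivisors A) x).1 *
      algebraMap A K (d (IsLocalization.sec (nonZeroDivisors A) x).2)) /
    algebraMap A K (IsLocalization.sec (nonZeroDivisors A) x).2 ^ 2

theorem sec_snd_ne_zero (x : K) :
    algebraMap A K (IsLocalization.sec (nonZeroDivisors A) x).2 ≠ 0 :=
  (IsLocalization.map_units K (IsLocalization.sec (nonZeroDivisors A) x).2).ne_zero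

theorem quotientRule_eq (d : Derivation R A A) {x : K} {f g : A}
    (hg : algebraMap A K g ≠ 0) (h : x * algebraMap A K g = algebraMap A K f) :
    quotientRule d x =
      (algebraMap A K (d f) * algebraMap A K g - algebraMap A K f * algebraMap A K (d g)) /
        algebraMap A K g ^ 2 := by
  unfold quotientRule
  have hs := IsLocalization.sec_spec (nonZeroDivisors A) x
  have hb := sec_snd_ne_zero (A := A) x
  revert hs hb
  generalize (IsLocalization.sec (nonZeroDivisors A) x).1 = a
  generalize ((IsLocalization.sec (nonZeroDivisors A) x).2 : A) = b
  intro hs hb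
  have h1 : a * g = f * b := by
    apply IsFractionRing.injective A K
    rw [map_mul, map_mul, ← hs, ← h]; ring
  have h2 : algebraMap A K (d a) * algebraMap A K g + algebraMap A K a * algebraMap A K (d g) =
      algebraMap A K (d f) * algebraMap A K b + algebraMap A K f * algebraMap A K (d b) := by
    have := congrArg (fun t => algebraMap A K (d t)) h1
    simp only [Derivation.leibniz, smul_eq_mul, map_add, map_mul] at this
    linear_combination this
  rw [div_eq_div_iff (pow_ne_zero 2 hb) (pow_ne_zero 2 hg)]
  rw [← hs, ← h] at h2 ⊢
  linear_combination (algebraMap A K g * algebraMap A K b) * h2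

theorem exists_fraction (x : K) :
    ∃ f g : A, algebraMap A K g ≠ 0 ∧ x * algebraMap A K g = algebraMap A K f :=
  ⟨_, _, sec_snd_ne_zero (A := A) x, IsLocalization.sec_spec _ x⟩

variable [Algebra R K] [IsScalarTower R A K]

/-- The unique extension of a derivation of `A` to a derivation of its fraction field `K`. -/
def fractionDerivation (d : Derivation R A A) : Derivation R K K :=
  Derivation.mk'
    { toFun := quotientRule d
      map_add' := fun x y => by
        obtain ⟨f, g, hg, h⟩ := exists_fraction (A := A) x
        obtain ⟨f', g', hg', h'⟩ := exists_fraction (A := A) y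
        rw [quotientRule_eq d hg h, quotientRule_eq d hg' h',
          quotientRule_eq d (f := f * g' + f' * g) (g := g * g') (by simp [hg, hg'])
            (by simp only [map_add, map_mul, ← h, ← h']; ring)]
        simp only [Derivation.leibniz, smul_eq_mul, map_add, map_mul]
        field_simp
        ring
      map_smul' := fun c x => by
        obtain ⟨f, g, hg, h⟩ := exists_fraction (A := A) x
        have hc (t : A) : algebraMap A K (c • t) = algebraMap R K c * algebraMap A K t := by
          rw [Algebra.smul_def, map_mul, ← IsScalarTower.algebraMap_apply]
        rw [quotientRule_eq d hg h, quotientRule_eq d (f := c • f) (g := g) hg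
          (by rw [Algebra.smul_mul_assoc, h, hc, Algebra.smul_def]), Derivation.map_smul, hc, hc,
          RingHom.id_apply, Algebra.smul_def]
        ring }
    (fun x y => by
        obtain ⟨f, g, hg, h⟩ := exists_fraction (A := A) x
        obtain ⟨f', g', hg', h'⟩ := exists_fraction (A := A) y
        change quotientRule d (x * y) = x • quotientRule d y + y • quotientRule d x
        rw [quotientRule_eq d hg h, quotientRule_eq d hg' h',
          quotientRule_eq d (f := f * f') (g := g * g') (by simp [hg, hg'])
            (by simp only [map_mul, ← h, ← h']; ring)]
        have e1 : x = algebraMap A K f / algebraMap A K g := by rw [← h]; field_simp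
        have e2 : y = algebraMap A K f' / algebraMap A K g' := by rw [← h']; field_simp
        rw [e1, e2]
        simp only [Derivation.leibniz, smul_eq_mul, map_add, map_mul]
        field_simp
        ring)

theorem fractionDerivation_algebraMap (d : Derivation R A A) (f : A) :
    (fractionDerivation d : Derivation R K K) (algebraMap A K f) = algebraMap A K (d f) := by
  change quotientRule d _ = _
  rw [quotientRule_eq d (f := f) (g := 1) (by simp) (by simp)]
  simp

end FractionDerivation

/-! ### Analytic functions on an open disk and their fractions -/

/-- The ring of power series `∑ a_s T ^ s` over `Ω` with radius of convergence at least `ρ`, that is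
`‖a_s‖ r ^ s → 0` for all `0 < r < ρ`.  For a disk with centre `a`, `T` is `z - a`. -/
def analyticRing (Ω : Type*) [NormedField Ω] [IsUltrametricDist Ω] (ρ : ℝ) :
    Subalgebra Ω Ω⟦X⟧ where
  carrier := {f | ∀ r : ℝ, 0 < r → r < ρ → IsRestricted r f}
  mul_mem' hf hg r h0 h1 := isRestricted.mul r (hf r h0 h1) (hg r h0 h1)
  add_mem' hf hg r h0 h1 := isRestricted.add r (hf r h0 h1) (hg r h0 h1)
  algebraMap_mem' c r _ _ := isRestricted_C r c

/-- The field of fractions of `analyticRing Ω ρ`. -/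
abbrev meroField (Ω : Type*) [NormedField Ω] [IsUltrametricDist Ω] (ρ : ℝ) : Type _ :=
  FractionRing (analyticRing Ω ρ)

section Analytic
variable {Ω : Type*} [NormedField Ω] [IsUltrametricDist Ω] {ρ : ℝ}

theorem derivative_mem {f : Ω⟦X⟧} (hf : f ∈ analyticRing Ω ρ) :
    PowerSeries.derivative Ω f ∈ analyticRing Ω ρ := by
  intro r h0 h1
  have h := (isRestricted_iff' r f).1 (hf r h0 h1)
  rw [isRestricted_iff']
  have h2 : Tendsto (fun s : ℕ => ‖coeff (s + 1) f‖ * r ^ (s + 1) * r⁻¹) atTop (𝓝 0) := by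
    simpa using (h.comp (tendsto_add_atTop_nat 1)).mul_const r⁻¹
  refine squeeze_zero (fun s => by positivity) (fun s => ?_) h2
  have h3 : ‖((s : Ω) + 1)‖ ≤ 1 := by
    simpa using IsUltrametricDist.norm_natCast_le_one Ω (s + 1)
  rw [coeff_derivative, norm_mul, pow_succ]
  have : ‖coeff (s + 1) f‖ * (r ^ s * r) * r⁻¹ = ‖coeff (s + 1) f‖ * r ^ s := by
    field_simp
  rw [this]
  gcongr
  exact mul_le_of_le_one_right (norm_nonneg _) h3

variable (Ω ρ) in
/-- `d/dT` on `analyticRing Ω ρ`. -/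
def analyticDerivation : Derivation Ω (analyticRing Ω ρ) (analyticRing Ω ρ) :=
  Derivation.mk'
    { toFun := fun f => ⟨PowerSeries.derivative Ω f, derivative_mem f.2⟩
      map_add' := fun f g => Subtype.ext (map_add (PowerSeries.derivative Ω) (f : Ω⟦X⟧) g)
      map_smul' := fun c f => Subtype.ext ((PowerSeries.derivative Ω).map_smul c (f : Ω⟦X⟧)) }
    (fun f g => Subtype.ext ((PowerSeries.derivative Ω).leibniz (f : Ω⟦X⟧) g))

variable (Ω ρ) in
/-- `D = d/dT` on `meroField Ω ρ`. -/
def D : Derivation Ω (meroField Ω ρ) (meroField Ω ρ) :=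
  fractionDerivation (analyticDerivation Ω ρ)

/-! ### Norms -/

/-- The norm `|f|_0(R) = sup_s ‖a_s‖ R ^ s` of a power series `f = ∑ a_s T ^ s`. -/
def radialNorm (R : ℝ) (f : Ω⟦X⟧) : ℝ := PowerSeries.gaussNorm (‖·‖) R f

/-- The extension `|f / g|_0(R) = |f|_0(R) / |g|_0(R)` of `radialNorm R` to `meroField Ω ρ`
(independent of the choice of `f` and `g` by `fracRadialNorm_eq`). -/
def fracRadialNorm (R : ℝ) (h : meroField Ω ρ) : ℝ :=
  radialNorm R ((IsLocalization.sec (nonZeroDivisors (analyticRing Ω ρ)) h).1 : Ω⟦X⟧) /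
    radialNorm R
      (((IsLocalization.sec (nonZeroDivisors (analyticRing Ω ρ)) h).2 : analyticRing Ω ρ) : Ω⟦X⟧)

/-- The norm `‖h‖ = limsup_{R → ρ⁻} |h|_0(R)`, with values in `[0, ∞]`. -/
def boundaryNorm (h : meroField Ω ρ) : ℝ≥0∞ :=
  limsup (fun R : ℝ => ENNReal.ofReal (fracRadialNorm R h)) (𝓝[<] ρ)

/-- The maximum of the norms of the entries of a matrix. -/
def matrixNorm {n : ℕ} (M : Matrix (Fin n) (Fin n) (meroField Ω ρ)) : ℝ≥0∞ :=
  ⨆ i, ⨆ j, boundaryNorm (M i j)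

/-! ### Wronskian matrices and differential systems -/

/-- The Wronskian matrix `(D ^ i u_j)`, `0 ≤ i, j < n`. -/
def wronskian {n : ℕ} (u : Fin n → meroField Ω ρ) : Matrix (Fin n) (Fin n) (meroField Ω ρ) :=
  Matrix.of fun i j => (D Ω ρ)^[(i : ℕ)] (u j)

/-- The matrices `A_s` such that `D ^ s y / s! = A_s y` whenever `D y = A y`:
`A_0 = 1` and `(s + 1) A_{s+1} = D A_s + A_s A`. -/
def iterMatrix {n : ℕ} (A : Matrix (Fin n) (Fin n) (meroField Ω ρ)) :
    ℕ → Matrix (Fin n) (Fin n) (meroField Ω ρ)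
  | 0 => 1
  | s + 1 => ((s + 1 : ℕ) : meroField Ω ρ)⁻¹ •
      ((iterMatrix A s).map (D Ω ρ) + iterMatrix A s * A)

end Analytic

/-- `{s, m}_p`: the maximum of `1 / |λ_1 ⋯ λ_k|_p` over the integers
`1 ≤ λ_1 < ⋯ < λ_k ≤ s` with `k ≤ m`. Since every factor `1 / |λ_i|_p` is at least `1`, only
`k = m` matters if `m ≤ s`. -/
def brace (p : ℕ) [Fact p.Prime] (s m : ℕ) : ℝ≥0 :=
  ((Finset.Icc 1 s).powerset.filter fun t => t.card ≤ m).sup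
    fun t => ∏ l ∈ t, ‖((l : ℕ) : ℚ_[p])‖₊⁻¹

/-! ### Consistency of the definitions -/

section Consistency
variable {Ω : Type*} [NormedField Ω]

/-- There is a least index at which the Gauss norm is attained. -/
theorem exists_dominant {R : ℝ} (hR : 0 < R) {f : Ω⟦X⟧} (hf : IsRestricted R f) (h0 : f ≠ 0) :
    ∃ i, (∀ k, ‖coeff k f‖ * R ^ k ≤ ‖coeff i f‖ * R ^ i) ∧
      (∀ k < i, ‖coeff k f‖ * R ^ k < ‖coeff i f‖ * R ^ i) ∧ 0 < ‖coeff i f‖ * R ^ i := by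
  obtain ⟨j, hj⟩ : ∃ j, coeff j f ≠ 0 := by
    by_contra! h; exact h0 (PowerSeries.ext (by simpa using h))
  have hpos : 0 < ‖coeff j f‖ * R ^ j := by positivity
  have hex : ∃ i, ∀ k, ‖coeff k f‖ * R ^ k ≤ ‖coeff i f‖ * R ^ i := by
    have ht := (isRestricted_iff' R f).1 hf
    obtain ⟨N, hN⟩ := eventually_atTop.1 (ht.eventually (gt_mem_nhds hpos))
    obtain ⟨i, -, hi⟩ := Finset.exists_max_image (Finset.range (max N (j + 1)))
      (fun k => ‖coeff k f‖ * R ^ k) ⟨j, by simp⟩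
    refine ⟨i, fun k => ?_⟩
    by_cases hk : k < max N (j + 1)
    · exact hi k (by simpa using hk)
    · exact (hN k (by omega)).le.trans (hi j (by simp))
  classical
  refine ⟨Nat.find hex, Nat.find_spec hex, fun k hk => ?_, hpos.trans_le (Nat.find_spec hex j)⟩
  have := Nat.find_min hex hk
  push Not at this
  obtain ⟨m, hm⟩ := this
  exact hm.trans_le (Nat.find_spec hex m)

theorem radialNorm_eq [IsUltrametricDist Ω] {R : ℝ} {f : Ω⟦X⟧} {i : ℕ}
    (h : ∀ k, ‖coeff k f‖ * R ^ k ≤ ‖coeff i f‖ * R ^ i) :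
    radialNorm R f = ‖coeff i f‖ * R ^ i := by
  rw [radialNorm, gaussNorm_eq]
  exact le_antisymm (ciSup_le h) (le_ciSup (f := fun k => ‖coeff k f‖ * R ^ k)
    ⟨_, Set.forall_mem_range.2 h⟩ i)

theorem radialNorm_zero [IsUltrametricDist Ω] (R : ℝ) : radialNorm R (0 : Ω⟦X⟧) = 0 :=
  gaussNorm_zero _ _ (by simp)

theorem radialNorm_pos [IsUltrametricDist Ω] {R : ℝ} (hR : 0 < R) {f : Ω⟦X⟧}
    (hf : IsRestricted R f) (h0 : f ≠ 0) : 0 < radialNorm R f := by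
  obtain ⟨i, hi, -, hip⟩ := exists_dominant hR hf h0
  rwa [radialNorm_eq hi]

theorem radialNorm_mul [IsUltrametricDist Ω] {R : ℝ} (hR : 0 < R) {f g : Ω⟦X⟧}
    (hf : IsRestricted R f) (hg : IsRestricted R g) :
    radialNorm R (f * g) = radialNorm R f * radialNorm R g := by
  rcases eq_or_ne f 0 with rfl | hf0
  · simp [radialNorm_zero]
  rcases eq_or_ne g 0 with rfl | hg0
  · simp [radialNorm_zero]
  obtain ⟨i, hi, hi', hip⟩ := exists_dominant hR hf hf0
  obtain ⟨j, hj, hj', hjp⟩ := exists_dominant hR hg hg0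
  rw [radialNorm_eq hi, radialNorm_eq hj]
  have hterm (a b : ℕ) : ‖coeff a f * coeff b g‖ * R ^ (a + b) =
      (‖coeff a f‖ * R ^ a) * (‖coeff b g‖ * R ^ b) := by rw [norm_mul, pow_add]; ring
  have h0 : 0 < ‖coeff i f * coeff j g‖ := by
    have : 0 < ‖coeff i f * coeff j g‖ * R ^ (i + j) := by rw [hterm]; positivity
    exact pos_of_mul_pos_left this (by positivity)
  have hmain : ‖coeff (i + j) (f * g)‖ = ‖coeff i f * coeff j g‖ := by
    have hij : (i, j) ∈ Finset.HasAntidiagonal.antidiagonal (i + j) :=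
      Finset.HasAntidiagonal.mem_antidiagonal.2 rfl
    rw [coeff_mul, ← Finset.add_sum_erase _ _ hij]
    have hlt : ‖∑ x ∈ (Finset.HasAntidiagonal.antidiagonal (i + j)).erase (i, j), coeff x.1 f * coeff x.2 g‖ <
        ‖coeff i f * coeff j g‖ := by
      rcases ((Finset.HasAntidiagonal.antidiagonal (i + j)).erase (i, j)).eq_empty_or_nonempty with h | h
      · rw [h]; simpa using h0
      obtain ⟨⟨a, b⟩, hx, hle⟩ := IsUltrametricDist.exists_norm_finsetSum_le_of_nonempty h
        (fun x : ℕ × ℕ => coeff x.1 f * coeff x.2 g)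
      refine hle.trans_lt ?_
      simp only [Finset.mem_erase, Finset.HasAntidiagonal.mem_antidiagonal, ne_eq, Prod.mk.injEq] at hx
      have hRp : 0 < R ^ (i + j) := by positivity
      refine lt_of_mul_lt_mul_right ?_ hRp.le
      rw [hterm, ← hx.2, hterm]
      rcases lt_or_ge a i with ha | ha
      · exact (mul_le_mul_of_nonneg_left (hj b) (by positivity)).trans_lt
          (mul_lt_mul_of_pos_right (hi' a ha) hjp)
      · have hb : b < j := by
          by_contra hb
          exact hx.1 ⟨by omega, by omega⟩
        exact mul_lt_mul' (hi a) (hj' b hb) (by positivity) hip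
    rw [IsUltrametricDist.norm_add_eq_max_of_norm_ne_norm hlt.ne', max_eq_left hlt.le]
  rw [radialNorm_eq (i := i + j), hmain, hterm]
  intro k
  rw [hmain, hterm, coeff_mul]
  have hRp : 0 < R ^ k := by positivity
  rw [← le_div_iff₀ hRp]
  refine IsUltrametricDist.norm_sum_le_of_forall_le_of_nonneg (by positivity) fun x hx => ?_
  rw [le_div_iff₀ hRp, ← Finset.HasAntidiagonal.mem_antidiagonal.1 hx, hterm]
  exact mul_le_mul (hi _) (hj _) (by positivity) hip.le

/-- The extension of `radialNorm R` to fractions does not depend on the chosen fraction. -/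
theorem fracRadialNorm_eq [IsUltrametricDist Ω] {ρ R : ℝ} (hR : 0 < R) (hRρ : R < ρ)
    {h : meroField Ω ρ} {f g : analyticRing Ω ρ} (hg : g ≠ 0)
    (e : h * algebraMap _ (meroField Ω ρ) g = algebraMap _ (meroField Ω ρ) f) :
    fracRadialNorm R h = radialNorm R (f : Ω⟦X⟧) / radialNorm R (g : Ω⟦X⟧) := by
  unfold fracRadialNorm
  have hs := IsLocalization.sec_spec (nonZeroDivisors (analyticRing Ω ρ)) h
  have hb := nonZeroDivisors.coe_ne_zero
    (IsLocalization.sec (nonZeroDivisors (analyticRing Ω ρ)) h).2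
  revert hs hb
  generalize (IsLocalization.sec (nonZeroDivisors (analyticRing Ω ρ)) h).1 = a
  generalize ((IsLocalization.sec (nonZeroDivisors (analyticRing Ω ρ)) h).2 :
    analyticRing Ω ρ) = b
  intro hs hb
  have h1 : a * g = f * b := by
    apply IsFractionRing.injective (analyticRing Ω ρ) (meroField Ω ρ)
    rw [map_mul, map_mul, ← hs, ← e]; ring
  have p (x : analyticRing Ω ρ) (hx : x ≠ 0) : 0 < radialNorm R (x : Ω⟦X⟧) :=
    radialNorm_pos hR (x.2 R hR hRρ) (by simpa using hx)
  rw [div_eq_div_iff (p b hb).ne' (p g hg).ne',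
    ← radialNorm_mul hR (a.2 R hR hRρ) (g.2 R hR hRρ),
    ← radialNorm_mul hR (f.2 R hR hRρ) (b.2 R hR hRρ)]
  exact congrArg (fun t : analyticRing Ω ρ => radialNorm R (t : Ω⟦X⟧)) h1

/-- If `Ω` is complete with dense value group, then `analyticRing Ω ρ` consists of the power series
that converge at all points of the open disk of radius `ρ` and centre `a`. -/
theorem mem_analyticRing_iff [IsUltrametricDist Ω] [CompleteSpace Ω]
    (hΩ : ∀ r t : ℝ, 0 < r → r < t → ∃ x : Ω, r < ‖x‖ ∧ ‖x‖ < t) (a : Ω) {ρ : ℝ} {f : Ω⟦X⟧} :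
    f ∈ analyticRing Ω ρ ↔ ∀ x : Ω, ‖x - a‖ < ρ → Summable fun s => coeff s f * (x - a) ^ s := by
  constructor
  · intro hf x hx
    rcases eq_or_ne (x - a) 0 with h | h
    · rw [h]
      refine summable_of_ne_finset_zero (s := {0}) fun s hs => ?_
      rw [zero_pow (by simpa using hs), mul_zero]
    · refine NonarchimedeanAddGroup.summable_of_tendsto_cofinite_zero ?_
      rw [tendsto_zero_iff_norm_tendsto_zero]
      simpa using (isRestricted_iff _ f).1 (hf ‖x - a‖ (norm_pos_iff.2 h) hx)
  · intro hf r h0 h1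
    obtain ⟨x, hx, hx'⟩ := hΩ r ρ h0 h1
    have := (hf (x + a) (by simpa using hx')).tendsto_cofinite_zero
    rw [tendsto_zero_iff_norm_tendsto_zero] at this
    rw [isRestricted_iff]
    refine squeeze_zero (fun s => by positivity) (fun s => ?_) this
    simp only [add_sub_cancel_right, norm_mul, norm_pow]
    gcongr

/-- If `Ω` is complete with infinite residue field, then the Gauss norm at `R = ‖y‖` is the maximum of
the absolute values taken on the sphere of radius `R`. -/
theorem radialNorm_isGreatest [IsUltrametricDist Ω] [CompleteSpace Ω]
    (hΩ : Infinite (IsLocalRing.ResidueField (NormedField.valuation (K := Ω)).valuationSubring))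
    {y : Ω} (hy : y ≠ 0) {f : Ω⟦X⟧} (hf : IsRestricted ‖y‖ f) :
    IsGreatest {v : ℝ | ∃ x : Ω, ‖x‖ = ‖y‖ ∧ v = ‖∑' s, coeff s f * x ^ s‖} (radialNorm ‖y‖ f) := by
  have hy' : 0 < ‖y‖ := norm_pos_iff.2 hy
  have hsum (x : Ω) (hx : ‖x‖ = ‖y‖) : Summable fun s => coeff s f * x ^ s := by
    refine NonarchimedeanAddGroup.summable_of_tendsto_cofinite_zero ?_
    rw [tendsto_zero_iff_norm_tendsto_zero]
    simpa [hx] using (isRestricted_iff _ f).1 hf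
  rcases eq_or_ne f 0 with rfl | hf0
  · rw [radialNorm_zero]
    exact ⟨⟨y, rfl, by simp⟩, by rintro v ⟨x, -, rfl⟩; simp⟩
  obtain ⟨i, hi, -, hip⟩ := exists_dominant hy' hf hf0
  rw [radialNorm_eq hi]
  refine ⟨?_, ?_⟩
  · set O := (NormedField.valuation (K := Ω)).valuationSubring with hO
    have hmem (x : Ω) : x ∈ O ↔ ‖x‖ ≤ 1 := by
      rw [hO, Valuation.mem_valuationSubring_iff, NormedField.valuation_apply]
      exact Iff.rfl
    have hunit (x : O) : IsLocalRing.residue O x ≠ 0 ↔ ‖(x : Ω)‖ = 1 := by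
      rw [IsLocalRing.residue_ne_zero_iff_isUnit]
      constructor
      · rintro ⟨u, rfl⟩
        have h1 := (hmem _).1 (u : O).2
        have h2 := (hmem _).1 ((u⁻¹ : Oˣ) : O).2
        have h3 : ‖((u : O) : Ω)‖ * ‖(((u⁻¹ : Oˣ) : O) : Ω)‖ = 1 := by
          rw [← norm_mul, ← MulMemClass.coe_mul, Units.mul_inv]; simp
        nlinarith [norm_nonneg ((u : O) : Ω), norm_nonneg (((u⁻¹ : Oˣ) : O) : Ω)]
      · intro h
        have h0 : (x : Ω) ≠ 0 := by intro h0; simp [h0] at h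
        exact IsUnit.of_mul_eq_one ⟨(x : Ω)⁻¹, (hmem _).2 (by simp [h])⟩
          (Subtype.ext (mul_inv_cancel₀ h0))
    set M := coeff i f * y ^ i with hM
    have hMn : 0 < ‖M‖ := by rw [hM]; simpa using hip
    set c : ℕ → Ω := fun s => coeff s f * y ^ s / M with hc
    have hc1 (s : ℕ) : ‖c s‖ ≤ 1 := by
      rw [hc]; simp only [norm_div]
      rw [div_le_one hMn, hM]; simpa using hi s
    have hci : c i = 1 := div_self (norm_pos_iff.1 hMn)
    have hct : Tendsto (fun s => ‖c s‖) atTop (𝓝 0) := by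
      simpa [hc, norm_div] using ((isRestricted_iff' _ f).1 hf).div_const ‖M‖
    obtain ⟨N, hN⟩ := eventually_atTop.1 (hct.eventually (gt_mem_nhds (by norm_num : (0:ℝ) < 1 / 2)))
    set N' := max N (i + 1)
    set P : Polynomial O := ∑ s ∈ Finset.range N', Polynomial.monomial s ⟨c s, (hmem _).2 (hc1 s)⟩
    have hP : P.coeff i = 1 := by
      simp only [P, Polynomial.finsetSum_coeff, Polynomial.coeff_monomial]
      rw [Finset.sum_ite_eq' (Finset.range N') i]
      rw [if_pos (by simp [N'])]
      exact Subtype.ext hci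
    have hPm : P.map (IsLocalRing.residue O) ≠ 0 := by
      intro h
      have := congrArg (fun q => Polynomial.coeff q i) h
      simp [hP] at this
    obtain ⟨t', ht'⟩ : ∃ t', (Polynomial.X * P.map (IsLocalRing.residue O)).eval t' ≠ 0 := by
      by_contra! h
      have h1 := Polynomial.eq_zero_of_infinite_isRoot
        (Polynomial.X * P.map (IsLocalRing.residue O)) (by
          rw [show {x | Polynomial.IsRoot _ x} = Set.univ from Set.eq_univ_of_forall h]
          exact Set.infinite_univ)
      exact (mul_ne_zero Polynomial.X_ne_zero hPm) h1
    obtain ⟨t, rfl⟩ := IsLocalRing.residue_surjective t'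
    rw [Polynomial.eval_mul, Polynomial.eval_X, Polynomial.eval_map_apply] at ht'
    have ht1 : ‖(t : Ω)‖ = 1 := (hunit t).1 (left_ne_zero_of_mul ht')
    have hPt := (hunit _).1 (right_ne_zero_of_mul ht')
    have hPt' : ((P.eval t : O) : Ω) = ∑ s ∈ Finset.range N', c s * (t : Ω) ^ s := by
      simp [P, Polynomial.eval_finsetSum]
    have hx : ‖y * t‖ = ‖y‖ := by rw [norm_mul, ht1, mul_one]
    refine ⟨y * t, hx, ?_⟩
    have hterm (s : ℕ) : coeff s f * (y * t) ^ s = M * (c s * (t : Ω) ^ s) := by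
      simp only [hc]; field_simp [norm_pos_iff.1 hMn]; ring
    have hs' : Summable fun s => c s * (t : Ω) ^ s := by
      have := hsum _ hx
      simp_rw [hterm] at this
      exact (summable_mul_left_iff (norm_pos_iff.1 hMn)).1 this
    simp_rw [hterm]
    rw [tsum_mul_left, ← hs'.sum_add_tsum_nat_add N', ← hPt']
    have htail : ‖∑' s, c (s + N') * (t : Ω) ^ (s + N')‖ ≤ 1 / 2 := by
      refine le_of_tendsto ((summable_nat_add_iff N').2 hs').hasSum.norm
        (Eventually.of_forall fun T => ?_)
      refine IsUltrametricDist.norm_sum_le_of_forall_le_of_nonneg (by positivity) fun s _ => ?_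
      rw [norm_mul, norm_pow, ht1, one_pow, mul_one]
      exact (hN _ (by omega)).le
    rw [norm_mul, IsUltrametricDist.norm_add_eq_max_of_norm_ne_norm (by rw [hPt]; linarith), hPt,
      max_eq_left (by linarith), mul_one, hM, norm_mul, norm_pow]
  · rintro v ⟨x, hx, rfl⟩
    refine le_of_tendsto (hsum x hx).hasSum.norm (Eventually.of_forall fun t => ?_)
    refine IsUltrametricDist.norm_sum_le_of_forall_le_of_nonneg (by positivity) fun s _ => ?_
    simpa [hx] using hi s

/-- The matrices `iterMatrix A s` have their defining property. -/
theorem iterMatrix_spec [IsUltrametricDist Ω] [CharZero Ω] {ρ : ℝ} {n : ℕ}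
    {A : Matrix (Fin n) (Fin n) (meroField Ω ρ)} {y : Fin n → meroField Ω ρ}
    (hy : ∀ i, D Ω ρ (y i) = A.mulVec y i) (s : ℕ) (i : Fin n) :
    ((s.factorial : ℕ) : meroField Ω ρ)⁻¹ * (D Ω ρ)^[s] (y i) = (iterMatrix A s).mulVec y i := by
  have : CharZero (meroField Ω ρ) := charZero_of_injective_algebraMap (algebraMap Ω (meroField Ω ρ)).injective
  rw [inv_mul_eq_iff_eq_mul₀ (by exact_mod_cast s.factorial_ne_zero)]
  induction s generalizing i with
  | zero => simp [iterMatrix]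
  | succ s ih =>
    have hs : ((s + 1 : ℕ) : meroField Ω ρ) ≠ 0 := by exact_mod_cast s.succ_ne_zero
    have key : D Ω ρ ((iterMatrix A s).mulVec y i) =
        (((iterMatrix A s).map (D Ω ρ) + iterMatrix A s * A).mulVec y) i := by
      rw [Matrix.add_mulVec, ← Matrix.mulVec_mulVec, Pi.add_apply]
      simp only [Matrix.mulVec, dotProduct, map_sum, Derivation.leibniz, smul_eq_mul,
        Finset.sum_add_distrib, Matrix.map_apply, hy]
      rw [add_comm]
      congr 1
      exact Finset.sum_congr rfl fun j _ => mul_comm _ _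
    rw [Function.iterate_succ_apply', ih, Derivation.leibniz, Derivation.map_natCast, key,
      iterMatrix, Matrix.smul_mulVec, Pi.smul_apply, smul_eq_mul, smul_eq_mul, smul_eq_mul,
      mul_zero, add_zero, Nat.factorial_succ, Nat.cast_mul]
    field_simp

end Consistency

end
end DworkRobba

/-! For each fixed radius R < ρ the Gauss norm is a non-archimedean absolute value on fractions of
analytic functions, and `D ^ s / s!` has operator norm at most `R ^ (-s)`: on a power series it
produces only integral binomial coefficients, and the Leibniz rule carries the bound over to
quotients (`dividedIterate_le_of_mul`).

The core is `exists_dividedIterate_eq_sum`, an induction on the number of functions. Choose a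
nonzero function w in the family. The quotients `w⁻¹ * u c` include the constant 1, so
differentiating them leaves one function fewer. Returning from `d (w⁻¹ * u c)` to `w⁻¹ * u c` costs
one division by an integer t + 1, which is where a new factor λ of `brace` comes from. Multiplying
back by w uses Leibniz twice, and the norms of w and `w⁻¹` cancel. Only existence of coefficients is
asserted, so no Wronskian enters the induction; neither w nor the coefficients depend on the radius,
so one choice satisfies the bounds for all R at once, as the limit R → ρ requires.

For a system, this applies to each row of Y. Since `D ^ k Y = k! A_k Y`, cancelling the invertible Y
writes a row of `A_s` as a combination of the same rows of the `k! A_k`, k < n. The estimates hold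
at every R, and the limsup R → ρ finishes the argument. -/

namespace DworkRobba
noncomputable section

/-! ### Divided powers of a derivation and the Leibniz rule -/

section DividedPowers
variable {R K : Type*} [CommRing R] [Field K] [Algebra R K]

/-- The divided iterate `d ^ s / s!` of a derivation `d`. -/
def dividedIterate (d : Derivation R K K) (s : ℕ) (x : K) : K :=
  ((s.factorial : ℕ) : K)⁻¹ * d^[s] x

theorem dividedIterate_zero (d : Derivation R K K) (x : K) : dividedIterate d 0 x = x := by
  simp [dividedIterate]

theorem dividedIterate_succ (d : Derivation R K K) (s : ℕ) (x : K) :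
    dividedIterate d (s + 1) x = ((s + 1 : ℕ) : K)⁻¹ * dividedIterate d s (d x) := by
  simp only [dividedIterate, Function.iterate_succ_apply, Nat.factorial_succ, Nat.cast_mul, mul_inv]
  ring

theorem iterate_mul (d : Derivation R K K) (s : ℕ) (x y : K) :
    d^[s] (x * y) = ∑ ij ∈ Finset.HasAntidiagonal.antidiagonal s,
      (s.choose ij.1 : K) * (d^[ij.1] x * d^[ij.2] y) := by
  induction s with
  | zero => simp
  | succ s ih =>
    rw [Finset.sum_antidiagonal_choose_succ_mul (fun i j => d^[i] x * d^[j] y),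
      Function.iterate_succ_apply', ih, map_sum, ← Finset.sum_add_distrib]
    refine Finset.sum_congr rfl fun ij hij => ?_
    -- Pascal's rule splits the sum in two, one of them with `s.choose ij.2`; symmetry of binomials
    -- merges them.
    have hs : s.choose ij.2 = s.choose ij.1 := by
      rw [← Finset.HasAntidiagonal.mem_antidiagonal.1 hij, Nat.choose_symm_add]
    simp only [Derivation.leibniz, Derivation.map_natCast, smul_eq_mul, Function.iterate_succ_apply',
      hs]
    ring

variable [CharZero K]

theorem iterate_eq_factorial_mul_dividedIterate (d : Derivation R K K) (s : ℕ) (x : K) :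
    d^[s] x = ((s.factorial : ℕ) : K) * dividedIterate d s x := by
  rw [dividedIterate, mul_inv_cancel_left₀ (by exact_mod_cast s.factorial_ne_zero)]

theorem dividedIterate_mul (d : Derivation R K K) (s : ℕ) (x y : K) :
    dividedIterate d s (x * y) = ∑ ij ∈ Finset.HasAntidiagonal.antidiagonal s,
      dividedIterate d ij.1 x * dividedIterate d ij.2 y := by
  rw [dividedIterate, iterate_mul, Finset.mul_sum]
  refine Finset.sum_congr rfl fun ij hij => ?_
  have h0 : ((s.factorial : ℕ) : K) ≠ 0 := by exact_mod_cast s.factorial_ne_zero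
  have h1 : ((ij.1.factorial : ℕ) : K) ≠ 0 := by exact_mod_cast ij.1.factorial_ne_zero
  have h2 : ((ij.2.factorial : ℕ) : K) ≠ 0 := by exact_mod_cast ij.2.factorial_ne_zero
  have h : (s.choose ij.1 : K) * ij.1.factorial * ij.2.factorial = s.factorial := by
    rw [← Finset.HasAntidiagonal.mem_antidiagonal.1 hij]
    exact_mod_cast Nat.choose_symm_add ▸ Nat.add_choose_mul_factorial_mul_factorial ij.1 ij.2
  simp only [dividedIterate]
  rw [← h] at h0 ⊢
  have h3 := left_ne_zero_of_mul (left_ne_zero_of_mul h0)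
  field_simp

end DividedPowers

/-! ### The Dwork–Robba induction over an abstract differential field -/

section Bounds

theorem _root_.IsNonarchimedean.apply_sum_le_of_forall_le {K α : Type*} [Field K] {v : AbsoluteValue K ℝ}
    (hv : IsNonarchimedean v) {t : Finset α} {f : α → K} {C : ℝ} (hC : 0 ≤ C)
    (h : ∀ a ∈ t, v (f a) ≤ C) : v (∑ a ∈ t, f a) ≤ C := by
  rcases t.eq_empty_or_nonempty with rfl | ht
  · simpa using hC
  · obtain ⟨a, ha, hle⟩ := hv.finset_image_add_of_nonempty f ht
    exact hle.trans (h a ha)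

variable {R K : Type*} [CommRing R] [Field K] [Algebra R K] [CharZero K]

/-- The bounds `|d ^ s / s!| ≤ r ^ (-s)` pass from `f` and `g` to the quotient of `f` by `g`. -/
theorem dividedIterate_le_of_mul (d : Derivation R K K) {v : AbsoluteValue K ℝ}
    (hv : IsNonarchimedean v) {r : ℝ} (hr : 0 < r) {h g : K} (hg : g ≠ 0)
    (hdg : ∀ s, v (dividedIterate d s g) ≤ (r ^ s)⁻¹ * v g)
    (hdf : ∀ s, v (dividedIterate d s (h * g)) ≤ (r ^ s)⁻¹ * v (h * g)) (s : ℕ) :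
    v (dividedIterate d s h) ≤ (r ^ s)⁻¹ * v h := by
  have hg0 : 0 < v g := v.pos hg
  have hnn := v.nonneg h
  induction s using Nat.strong_induction_on with
  | _ s ih =>
    -- Leibniz for h * g is solved for its top term, the s-th divided iterate of h times g; the
    -- other terms involve only lower iterates of h.
    have hmul := dividedIterate_mul d s h g
    rw [Finset.Nat.sum_antidiagonal_eq_sum_range_succ
      (fun i j => dividedIterate d i h * dividedIterate d j g),
      Finset.sum_range_succ, Nat.sub_self, dividedIterate_zero, ← sub_eq_iff_eq_add'] at hmul
    refine le_of_mul_le_mul_right ?_ hg0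
    rw [← map_mul, ← hmul, sub_eq_add_neg]
    refine (hv _ _).trans (max_le ?_ ?_)
    · rw [mul_assoc, ← map_mul]
      exact hdf s
    · rw [AbsoluteValue.map_neg]
      refine hv.apply_sum_le_of_forall_le (by positivity) fun i hi => ?_
      rw [Finset.mem_range] at hi
      rw [map_mul]
      calc _ ≤ (r ^ i)⁻¹ * v h * ((r ^ (s - i))⁻¹ * v g) := by
            gcongr
            · exact ih i hi
            · exact hdg _
        _ = _ := by
            rw [pow_sub₀ _ hr.ne' hi.le]
            field_simp

/-- The Leibniz rule for `d ^ k (x * u)`, `k < n`, as a sum over all `l < n`. -/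
theorem iterate_mul_eq_sum_fin (d : Derivation R K K) {n : ℕ} (k : Fin n) (x u : K) :
    d^[(k : ℕ)] (x * u) = ∑ l : Fin n,
      ((k : ℕ).choose l : K) * d^[(k : ℕ) - l] x * d^[(l : ℕ)] u := by
  rw [mul_comm x, iterate_mul, Finset.Nat.sum_antidiagonal_eq_sum_range_succ
    (fun i j => (((k : ℕ).choose i : ℕ) : K) * (d^[i] u * d^[j] x)),
    Fin.sum_univ_eq_sum_range (fun l => ((k : ℕ).choose l : K) * d^[(k : ℕ) - l] x * d^[l] u) n]
  -- The range l ≤ k is padded to l < n; the binomial kills the added terms.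
  refine (Finset.sum_congr rfl fun l _ => by ring).trans
    (Finset.sum_subset (Finset.range_subset_range.2 k.2) fun l _ hl => ?_)
  rw [Nat.choose_eq_zero_of_lt (by simpa using hl)]
  simp

/-- The theorem of Dwork and Robba for a family of non-archimedean absolute values `v i` on a
differential field, with `|d ^ s / s!|_i ≤ r_i ^ (-s)`. -/
theorem exists_dividedIterate_eq_sum {ι : Type*} (d : Derivation R K K)
    (v : ι → AbsoluteValue K ℝ) (r : ι → ℝ) (B : ℕ → ℕ → ℝ) (hr : ∀ i, 0 < r i)
    (hv : ∀ i, IsNonarchimedean (v i))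
    (hd : ∀ i s x, v i (dividedIterate d s x) ≤ (r i ^ s)⁻¹ * v i x)
    (hB : ∀ s m, 1 ≤ B s m) (hBmono : ∀ m, Monotone fun s => B s m)
    (hBstep : ∀ i s m, (v i ((s + 1 : ℕ) : K))⁻¹ * B s m ≤ B (s + 1) (m + 1))
    {n : ℕ} (u : Fin n → K) (s : ℕ) :
    ∃ G : Fin n → K, (∀ c, dividedIterate d s (u c) = ∑ j, G j * d^[(j : ℕ)] (u c)) ∧
      ∀ i j, v i (G j) ≤ r i ^ (j : ℕ) * (r i ^ s)⁻¹ * B s (n - 1) := by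
  have hB0 (s m : ℕ) : 0 ≤ B s m := zero_le_one.trans (hB s m)
  induction n generalizing s with
  | zero => exact ⟨Fin.elim0, fun c => c.elim0, fun _ j => j.elim0⟩
  | succ n ih =>
    by_cases hu : ∀ c, u c = 0
    · refine ⟨0, fun c => by simp [hu, dividedIterate], fun i j => ?_⟩
      have := hr i
      have := hB0 s n
      simp only [Pi.zero_apply, map_zero, Nat.add_sub_cancel]
      positivity
    push Not at hu
    obtain ⟨c₀, hw⟩ := hu
    set w := u c₀
    choose H hH hHb using ih fun c => d (w⁻¹ * u (c₀.succAbove c))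
    -- The relation also holds at the omitted index `c₀`, where `w⁻¹ * u c₀ = 1` has derivative 0.
    have hH' (t : ℕ) (c : Fin (n + 1)) : dividedIterate d t (d (w⁻¹ * u c)) =
        ∑ j, H t j * d^[(j : ℕ)] (d (w⁻¹ * u c)) := by
      rcases eq_or_ne c c₀ with rfl | hc
      · simp [w, inv_mul_cancel₀ hw, dividedIterate]
      · obtain ⟨c, rfl⟩ := Fin.exists_succAbove_eq hc
        exact hH t c
    obtain ⟨F, hF, hFb⟩ : ∃ F : ℕ → Fin (n + 1) → K,
        (∀ t c, dividedIterate d t (w⁻¹ * u c) = ∑ k, F t k * d^[(k : ℕ)] (w⁻¹ * u c)) ∧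
          ∀ i t k, v i (F t k) ≤ r i ^ (k : ℕ) * (r i ^ t)⁻¹ * B t n := by
      -- At t = 0 the operator is the identity. Otherwise the extra derivative shifts the index of
      -- `H` by one, leaving coefficient 0 at order zero.
      refine ⟨fun t => t.casesOn (Fin.cons 1 0) fun t =>
        Fin.cons 0 fun k => ((t + 1 : ℕ) : K)⁻¹ * H t k, fun t c => ?_, fun i t k => ?_⟩
      · cases t with
        | zero => simp [dividedIterate, Fin.sum_univ_succ]
        | succ t =>
          rw [dividedIterate_succ, hH', Fin.sum_univ_succ, Finset.mul_sum]
          simp [mul_assoc]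
      · have := hr i
        have := hB0 t n
        cases t with
        | zero =>
          refine Fin.cases ?_ (fun k => ?_) k
          · simpa using hB 0 n
          · change v i 0 ≤ _
            rw [map_zero]
            positivity
        | succ t =>
          refine Fin.cases ?_ (fun k => ?_) k
          · simp only [Fin.cons_zero, map_zero]
            positivity
          · simp only [Fin.cons_succ, map_mul, map_inv₀]
            -- An index k exists only when n > 0, so the truncated n - 1 of the induction hypothesis
            -- is a genuine predecessor and `hBstep` raises it to n.
            obtain ⟨m, rfl⟩ : ∃ m, n = m + 1 := ⟨n - 1, by have := k.2; omega⟩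
            calc _ ≤ (v i ((t + 1 : ℕ) : K))⁻¹ * (r i ^ (k : ℕ) * (r i ^ t)⁻¹ * B t m) := by
                  gcongr
                  exact hHb t i k
              _ = r i ^ (k : ℕ) * (r i ^ t)⁻¹ * ((v i ((t + 1 : ℕ) : K))⁻¹ * B t m) := by ring
              _ ≤ r i ^ (k : ℕ) * (r i ^ t)⁻¹ * B (t + 1) (m + 1) := by
                  gcongr
                  exact hBstep i t m
              _ = _ := by
                  rw [Fin.val_succ, pow_succ, pow_succ]
                  field_simp
    -- The coefficient of `d ^ l (u c)` after expanding `w * (w⁻¹ * u c)` by Leibniz, replacing the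
    -- iterates of the second factor by `F`, and expanding each `d ^ k (w⁻¹ * u c)` by Leibniz
    -- again.
    refine ⟨fun l => ∑ ab ∈ Finset.HasAntidiagonal.antidiagonal s, ∑ k : Fin (n + 1),
      dividedIterate d ab.1 w * F ab.2 k * (((k : ℕ).choose l : K) * d^[(k : ℕ) - l] w⁻¹),
      fun c => ?_, fun i l => ?_⟩
    · have hc : u c = w * (w⁻¹ * u c) := (mul_inv_cancel_left₀ hw _).symm
      conv_lhs => rw [hc, dividedIterate_mul]
      simp_rw [hF, iterate_mul_eq_sum_fin d _ w⁻¹ (u c), Finset.sum_mul, Finset.mul_sum]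
      rw [Finset.sum_comm]
      refine Eq.trans ?_ Finset.sum_comm
      rw [Finset.sum_comm]
      refine Finset.sum_congr rfl fun ab _ => ?_
      rw [Finset.sum_comm]
      exact Finset.sum_congr rfl fun l _ => Finset.sum_congr rfl fun k _ => by ring
    · have hri := hr i
      have hwi : 0 < v i w := (v i).pos hw
      have h0 : 0 ≤ r i ^ (l : ℕ) * (r i ^ s)⁻¹ * B s n := by
        have := hB0 s n
        positivity
      refine (hv i).apply_sum_le_of_forall_le h0 fun ab hab => (hv i).apply_sum_le_of_forall_le h0 fun k _ => ?_
      rcases lt_or_ge (k : ℕ) l with hkl | hkl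
      · simpa [Nat.choose_eq_zero_of_lt hkl] using h0
      rw [Finset.HasAntidiagonal.mem_antidiagonal] at hab
      -- The binomial and the factorial (k - l)! are integers, hence of absolute value at most 1, so
      -- the divided-power bound also covers the plain iterate.
      have hE : v i (((k : ℕ).choose l : K) * d^[(k : ℕ) - l] w⁻¹) ≤
          r i ^ (l : ℕ) * (r i ^ (k : ℕ))⁻¹ * (v i w)⁻¹ := by
        rw [iterate_eq_factorial_mul_dividedIterate, map_mul, map_mul, ← map_inv₀]
        have e : r i ^ (l : ℕ) * (r i ^ (k : ℕ))⁻¹ = (r i ^ ((k : ℕ) - l))⁻¹ := by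
          rw [pow_sub₀ _ hri.ne' hkl, mul_inv, inv_inv, mul_comm]
        rw [e]
        refine (mul_le_of_le_one_left (by positivity) (hv i).apply_natCast_le_one).trans ?_
        exact (mul_le_of_le_one_left (by positivity) (hv i).apply_natCast_le_one).trans (hd i _ _)
      rw [map_mul, map_mul]
      calc _ ≤ ((r i ^ ab.1)⁻¹ * v i w) * (r i ^ (k : ℕ) * (r i ^ ab.2)⁻¹ * B ab.2 n) *
            (r i ^ (l : ℕ) * (r i ^ (k : ℕ))⁻¹ * (v i w)⁻¹) := by
            have := hB0 ab.2 n
            gcongr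
            · exact hd i _ _
            · exact hFb i _ _
        _ = r i ^ (l : ℕ) * (r i ^ s)⁻¹ * B ab.2 n := by
            rw [← hab, pow_add]
            field_simp
        _ ≤ _ := by
            gcongr
            exact hBmono n (by omega)

end Bounds

/-! ### Gauss norms as absolute values, and the norm of `D ^ s / s!` -/

section RadialNorm
variable {Ω : Type*} [NormedField Ω] [IsUltrametricDist Ω] {ρ R : ℝ}

omit [IsUltrametricDist Ω] in
theorem radialNorm_le {C : ℝ} {f : Ω⟦X⟧} (h : ∀ k, ‖coeff k f‖ * R ^ k ≤ C) :
    radialNorm R f ≤ C := by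
  rw [radialNorm, gaussNorm_eq]
  exact ciSup_le h

theorem le_radialNorm (hR : 0 < R) {f : Ω⟦X⟧} (hf : IsRestricted R f) (k : ℕ) :
    ‖coeff k f‖ * R ^ k ≤ radialNorm R f := by
  rcases eq_or_ne f 0 with rfl | h0
  · simp [radialNorm_zero]
  · obtain ⟨i, hi, -⟩ := exists_dominant hR hf h0
    exact (hi k).trans_eq (radialNorm_eq hi).symm

omit [IsUltrametricDist Ω] in
theorem radialNorm_nonneg (f : Ω⟦X⟧) : 0 ≤ radialNorm R f :=
  gaussNorm_nonneg (v := norm) (c := R) f norm_nonneg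

theorem radialNorm_add_le (hR : 0 < R) {f g : Ω⟦X⟧} (hf : IsRestricted R f)
    (hg : IsRestricted R g) :
    radialNorm R (f + g) ≤ max (radialNorm R f) (radialNorm R g) := by
  refine radialNorm_le fun k => ?_
  rw [map_add]
  calc _ ≤ max ‖coeff k f‖ ‖coeff k g‖ * R ^ k := by
        gcongr
        exact IsUltrametricDist.norm_add_le_max _ _
    _ = max (‖coeff k f‖ * R ^ k) (‖coeff k g‖ * R ^ k) := max_mul_of_nonneg _ _ (by positivity)
    _ ≤ _ := max_le_max (le_radialNorm hR hf k) (le_radialNorm hR hg k)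

theorem mem_analyticRing_isRestricted (hR : 0 < R) (hRρ : R < ρ) (f : analyticRing Ω ρ) :
    IsRestricted R (f : Ω⟦X⟧) := f.2 R hR hRρ

theorem radialNorm_C (c : Ω) : radialNorm R (C c : Ω⟦X⟧) = ‖c‖ := by
  rw [radialNorm_eq (i := 0) fun k => ?_]
  · simp
  · rcases eq_or_ne k 0 with rfl | hk
    · rfl
    · simp [coeff_C, hk]

theorem fracRadialNorm_algebraMap (hR : 0 < R) (hRρ : R < ρ) (f : analyticRing Ω ρ) :
    fracRadialNorm R (algebraMap _ (meroField Ω ρ) f) = radialNorm R (f : Ω⟦X⟧) := by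
  rw [fracRadialNorm_eq hR hRρ (f := f) (g := 1) one_ne_zero (by simp), OneMemClass.coe_one,
    ← map_one C, radialNorm_C, norm_one, div_one]

theorem exists_fraction_ne_zero (h : meroField Ω ρ) :
    ∃ f g : analyticRing Ω ρ, g ≠ 0 ∧
      h * algebraMap _ (meroField Ω ρ) g = algebraMap _ (meroField Ω ρ) f := by
  obtain ⟨f, g, hg, e⟩ := exists_fraction (A := analyticRing Ω ρ) h
  exact ⟨f, g, fun h0 => hg (by rw [h0, map_zero]), e⟩

theorem radialNorm_coe_pos (hR : 0 < R) (hRρ : R < ρ) {f : analyticRing Ω ρ} (hf : f ≠ 0) :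
    0 < radialNorm R (f : Ω⟦X⟧) :=
  radialNorm_pos hR (mem_analyticRing_isRestricted hR hRρ f) (by simpa using hf)

theorem fracRadialNorm_nonneg (h : meroField Ω ρ) : 0 ≤ fracRadialNorm R h :=
  div_nonneg (radialNorm_nonneg _) (radialNorm_nonneg _)

theorem fracRadialNorm_mul (hR : 0 < R) (hRρ : R < ρ) (x y : meroField Ω ρ) :
    fracRadialNorm R (x * y) = fracRadialNorm R x * fracRadialNorm R y := by
  obtain ⟨f, g, hg, e⟩ := exists_fraction_ne_zero x
  obtain ⟨f', g', hg', e'⟩ := exists_fraction_ne_zero y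
  rw [fracRadialNorm_eq hR hRρ hg e, fracRadialNorm_eq hR hRρ hg' e',
    fracRadialNorm_eq hR hRρ (f := f * f') (mul_ne_zero hg hg')
      (by simp only [map_mul, ← e, ← e']; ring),
    MulMemClass.coe_mul, MulMemClass.coe_mul,
    radialNorm_mul hR (f.2 R hR hRρ) (f'.2 R hR hRρ),
    radialNorm_mul hR (g.2 R hR hRρ) (g'.2 R hR hRρ), mul_div_mul_comm]

theorem fracRadialNorm_add_le_max (hR : 0 < R) (hRρ : R < ρ) (x y : meroField Ω ρ) :
    fracRadialNorm R (x + y) ≤ max (fracRadialNorm R x) (fracRadialNorm R y) := by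
  obtain ⟨f, g, hg, e⟩ := exists_fraction_ne_zero x
  obtain ⟨f', g', hg', e'⟩ := exists_fraction_ne_zero y
  have hgg := mul_ne_zero hg hg'
  -- Over a common denominator the claim reduces to numerators.
  rw [fracRadialNorm_eq hR hRρ (h := x) (f := f * g') hgg (by simp only [map_mul, ← e]; ring),
    fracRadialNorm_eq hR hRρ (h := y) (f := f' * g) hgg (by simp only [map_mul, ← e']; ring),
    fracRadialNorm_eq hR hRρ (h := x + y) (f := f * g' + f' * g) hgg
      (by simp only [map_mul, map_add, ← e, ← e']; ring),
    max_div_div_right (radialNorm_nonneg _)]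
  exact div_le_div_of_nonneg_right (radialNorm_add_le hR
    (mem_analyticRing_isRestricted hR hRρ _) (mem_analyticRing_isRestricted hR hRρ _))
    (radialNorm_nonneg _)

theorem fracRadialNorm_eq_zero_iff (hR : 0 < R) (hRρ : R < ρ) (x : meroField Ω ρ) :
    fracRadialNorm R x = 0 ↔ x = 0 := by
  obtain ⟨f, g, hg, e⟩ := exists_fraction_ne_zero x
  have hg0 : algebraMap _ (meroField Ω ρ) g ≠ 0 := by simpa using hg
  rw [fracRadialNorm_eq hR hRρ hg e, div_eq_zero_iff,
    or_iff_left (radialNorm_coe_pos hR hRρ hg).ne']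
  constructor
  · intro h
    have hf : f = 0 := by
      by_contra hf
      exact (radialNorm_coe_pos hR hRρ hf).ne' h
    rw [hf, map_zero] at e
    exact (mul_eq_zero.1 e).resolve_right hg0
  · rintro rfl
    rw [zero_mul, eq_comm, map_eq_zero_iff _ (IsFractionRing.injective _ _)] at e
    rw [e, ZeroMemClass.coe_zero, radialNorm_zero]

/-- `fracRadialNorm R` as an absolute value on `meroField Ω ρ`. -/
def fracAbs (hR : 0 < R) (hRρ : R < ρ) : AbsoluteValue (meroField Ω ρ) ℝ where
  toFun := fracRadialNorm R
  map_mul' := fracRadialNorm_mul hR hRρ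
  nonneg' := fracRadialNorm_nonneg
  eq_zero' := fracRadialNorm_eq_zero_iff hR hRρ
  add_le' x y := (fracRadialNorm_add_le_max hR hRρ x y).trans
    (max_le_add_of_nonneg (fracRadialNorm_nonneg x) (fracRadialNorm_nonneg y))

theorem fracAbs_apply (hR : 0 < R) (hRρ : R < ρ) (h : meroField Ω ρ) :
    fracAbs hR hRρ h = fracRadialNorm R h := rfl

theorem isNonarchimedean_fracAbs (hR : 0 < R) (hRρ : R < ρ) :
    IsNonarchimedean (fracAbs (Ω := Ω) hR hRρ) :=
  fracRadialNorm_add_le_max hR hRρ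

theorem fracAbs_natCast (hR : 0 < R) (hRρ : R < ρ) (m : ℕ) :
    fracAbs hR hRρ (m : meroField Ω ρ) = ‖(m : Ω)‖ := by
  have h := fracRadialNorm_algebraMap hR hRρ (m : analyticRing Ω ρ)
  have e : (((m : analyticRing Ω ρ)) : Ω⟦X⟧) = C (m : Ω) := by simp
  rwa [e, radialNorm_C, map_natCast] at h

theorem iterate_D_algebraMap (s : ℕ) (f : analyticRing Ω ρ) :
    (D Ω ρ)^[s] (algebraMap _ (meroField Ω ρ) f) =
      algebraMap _ (meroField Ω ρ) ((analyticDerivation Ω ρ)^[s] f) := by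
  induction s with
  | zero => rfl
  | succ s ih =>
    rw [Function.iterate_succ_apply', Function.iterate_succ_apply', ih, D,
      fractionDerivation_algebraMap]

theorem coe_iterate_analyticDerivation (s : ℕ) (f : analyticRing Ω ρ) :
    (((analyticDerivation Ω ρ)^[s] f : analyticRing Ω ρ) : Ω⟦X⟧) =
      (PowerSeries.derivative Ω)^[s] (f : Ω⟦X⟧) := by
  induction s with
  | zero => rfl
  | succ s ih =>
    rw [Function.iterate_succ_apply', Function.iterate_succ_apply', ← ih]
    rfl

/-- The s-th derivative multiplies coefficients by s! times a binomial coefficient, which has norm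
at most 1. Keeping s! as an exact factor lets it cancel in the divided power. -/
theorem radialNorm_iterate_derivative_le (hR : 0 < R) {f : Ω⟦X⟧} (hf : IsRestricted R f) (s : ℕ) :
    radialNorm R ((PowerSeries.derivative Ω)^[s] f) ≤
      ‖(s.factorial : Ω)‖ * ((R ^ s)⁻¹ * radialNorm R f) := by
  refine radialNorm_le fun k => ?_
  rw [coeff_iterate_derivative, Nat.ascFactorial_eq_factorial_mul_choose, norm_mul, Nat.cast_mul,
    norm_mul]
  calc _ ≤ ‖(s.factorial : Ω)‖ * 1 * ‖coeff (k + s) f‖ * R ^ k := by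
        gcongr
        exact IsUltrametricDist.norm_natCast_le_one Ω _
    _ = ‖(s.factorial : Ω)‖ * ((R ^ s)⁻¹ * (‖coeff (k + s) f‖ * R ^ (k + s))) := by
        rw [pow_add]
        field_simp
    _ ≤ _ := by
        gcongr
        exact le_radialNorm hR hf _

instance [CharZero Ω] : CharZero (meroField Ω ρ) :=
  charZero_of_injective_algebraMap (algebraMap Ω (meroField Ω ρ)).injective

theorem fracRadialNorm_dividedIterate_algebraMap_le [CharZero Ω] (hR : 0 < R) (hRρ : R < ρ) (s : ℕ)
    (f : analyticRing Ω ρ) :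
    fracRadialNorm R (dividedIterate (D Ω ρ) s (algebraMap _ (meroField Ω ρ) f)) ≤
      (R ^ s)⁻¹ * fracRadialNorm R (algebraMap _ (meroField Ω ρ) f) := by
  have hs : 0 < ‖(s.factorial : Ω)‖ := by simpa using s.factorial_ne_zero
  rw [dividedIterate, ← fracAbs_apply hR hRρ, map_mul, map_inv₀, fracAbs_natCast,
    iterate_D_algebraMap, fracAbs_apply, fracRadialNorm_algebraMap hR hRρ,
    fracRadialNorm_algebraMap hR hRρ, coe_iterate_analyticDerivation, inv_mul_le_iff₀ hs]
  exact radialNorm_iterate_derivative_le hR (mem_analyticRing_isRestricted hR hRρ f) s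

theorem fracAbs_dividedIterate_le [CharZero Ω] (hR : 0 < R) (hRρ : R < ρ) (s : ℕ)
    (h : meroField Ω ρ) :
    fracAbs hR hRρ (dividedIterate (D Ω ρ) s h) ≤ (R ^ s)⁻¹ * fracAbs hR hRρ h := by
  obtain ⟨f, g, hg, e⟩ := exists_fraction_ne_zero h
  have hg0 : algebraMap _ (meroField Ω ρ) g ≠ 0 := by simpa using hg
  refine dividedIterate_le_of_mul (D Ω ρ) (isNonarchimedean_fracAbs hR hRρ) hR hg0
    (fun s => fracRadialNorm_dividedIterate_algebraMap_le hR hRρ s g) (fun s => ?_) s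
  rw [e]
  exact fracRadialNorm_dividedIterate_algebraMap_le hR hRρ s f

end RadialNorm

/-! ### The constants `brace` and the p-adic norm of integers -/

section Brace
variable (p : ℕ) [Fact p.Prime]

theorem one_le_brace (s m : ℕ) : 1 ≤ brace p s m := by
  have h : (∅ : Finset ℕ) ∈ (Finset.Icc 1 s).powerset.filter fun t => t.card ≤ m := by simp
  exact Finset.prod_empty.symm.le.trans
    (Finset.le_sup (f := fun t : Finset ℕ => ∏ l ∈ t, ‖((l : ℕ) : ℚ_[p])‖₊⁻¹) h)

theorem brace_mono (m : ℕ) : Monotone fun s => brace p s m := by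
  intro s s' h
  refine Finset.sup_mono (Finset.filter_subset_filter _ (Finset.powerset_mono.2 ?_))
  exact Finset.Icc_subset_Icc_right h

/-- The integer s + 1 exceeds every λ ≤ s, so it can be adjoined to any set competing for `brace p s
m`. -/
theorem inv_nnnorm_mul_brace_le (s m : ℕ) :
    ‖((s + 1 : ℕ) : ℚ_[p])‖₊⁻¹ * brace p s m ≤ brace p (s + 1) (m + 1) := by
  conv_lhs => rw [brace]
  rw [NNReal.mul_finset_sup]
  refine Finset.sup_le fun t ht => ?_
  rw [Finset.mem_filter, Finset.mem_powerset] at ht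
  have hs : s + 1 ∉ t := fun h => by simpa using ht.1 h
  rw [← Finset.prod_insert (f := fun l : ℕ => ‖((l : ℕ) : ℚ_[p])‖₊⁻¹) hs]
  refine Finset.le_sup (f := fun t : Finset ℕ => ∏ l ∈ t, ‖((l : ℕ) : ℚ_[p])‖₊⁻¹) ?_
  rw [Finset.mem_filter, Finset.mem_powerset, Finset.card_insert_of_notMem hs]
  refine ⟨Finset.insert_subset (by simp) (ht.1.trans (Finset.Icc_subset_Icc_right (by omega))), ?_⟩
  omega

variable {p}

/-- In a Bézout relation a q + b p = 1 the term b p has norm below 1; were the norm of q also below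
1, so would be that of 1. -/
theorem norm_natCast_eq_one_of_not_dvd {F : Type*} [NormedField F] [IsUltrametricDist F]
    (hp : ‖(p : F)‖ = (p : ℝ)⁻¹) {q : ℕ} (hq : ¬p ∣ q) : ‖(q : F)‖ = 1 := by
  have hp1 := (Fact.out : p.Prime).one_lt
  have hcop : IsCoprime (q : ℤ) p :=
    Nat.isCoprime_iff_coprime.2 (((Fact.out : p.Prime).coprime_iff_not_dvd.2 hq).symm)
  refine le_antisymm (IsUltrametricDist.norm_natCast_le_one F q) ?_
  by_contra! hlt
  obtain ⟨a, b, hab⟩ := hcop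
  have hab' : (a : F) * q + b * p = 1 := by exact_mod_cast congrArg (Int.cast : ℤ → F) hab
  have h := IsUltrametricDist.norm_add_le_max ((a : F) * q) (b * p)
  rw [hab', norm_one, norm_mul, norm_mul, hp] at h
  have h1 := IsUltrametricDist.norm_intCast_le_one F a
  have h2 := IsUltrametricDist.norm_intCast_le_one F b
  have h3 : ((p : ℝ))⁻¹ < 1 := inv_lt_one_of_one_lt₀ (by exact_mod_cast hp1)
  exact absurd h (not_le.2 (max_lt
    ((mul_le_of_le_one_left (norm_nonneg _) h1).trans_lt hlt)
    ((mul_le_of_le_one_left (by positivity) h2).trans_lt h3)))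

theorem norm_natCast_eq_padicNorm {Ω : Type*} [NormedField Ω] [IsUltrametricDist Ω]
    (hp : ‖(p : Ω)‖ = (p : ℝ)⁻¹) {m : ℕ} (hm : m ≠ 0) : ‖(m : Ω)‖ = ‖(m : ℚ_[p])‖ := by
  obtain ⟨k, q, hq, rfl⟩ :=
    Nat.exists_eq_pow_mul_and_not_dvd hm p (Fact.out : p.Prime).one_lt.ne'
  simp only [Nat.cast_mul, Nat.cast_pow, norm_mul, norm_pow, hp, Padic.norm_p,
    norm_natCast_eq_one_of_not_dvd hp hq,
    norm_natCast_eq_one_of_not_dvd (F := ℚ_[p]) Padic.norm_p hq]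

end Brace

/-! ### Bounds at every radius and passage to the boundary -/

section Main
variable {p : ℕ} [Fact p.Prime] {Ω : Type*} [NormedField Ω] [IsUltrametricDist Ω] [CharZero Ω]
  {ρ : ℝ}

/-- `D ^ s / s!` on a family of `n` functions is a combination of the `D ^ j`, `j < n`, with
coefficients that satisfy the Dwork–Robba bounds for all radii. -/
theorem exists_dividedIterate_D_eq_sum (hp : ‖(p : Ω)‖ = (p : ℝ)⁻¹) {n : ℕ}
    (u : Fin n → meroField Ω ρ) (s : ℕ) :
    ∃ G : Fin n → meroField Ω ρ,
      (∀ c, dividedIterate (D Ω ρ) s (u c) = ∑ j, G j * (D Ω ρ)^[(j : ℕ)] (u c)) ∧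
      ∀ R, 0 < R → R < ρ → ∀ j,
        fracRadialNorm R (G j) ≤ R ^ (j : ℕ) * (R ^ s)⁻¹ * brace p s (n - 1) := by
  obtain ⟨G, hG, hb⟩ := exists_dividedIterate_eq_sum (ι := Set.Ioo 0 ρ) (D Ω ρ)
    (fun R => fracAbs R.2.1 R.2.2) (fun R => R) (fun s m => brace p s m) (fun R => R.2.1)
    (fun R => isNonarchimedean_fracAbs R.2.1 R.2.2)
    (fun R s x => fracAbs_dividedIterate_le R.2.1 R.2.2 s x)
    (fun s m => by exact_mod_cast one_le_brace p s m)
    (fun m s s' h => by exact_mod_cast brace_mono p m h)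
    (fun R s m => by
      rw [fracAbs_natCast, norm_natCast_eq_padicNorm hp s.succ_ne_zero]
      exact_mod_cast inv_nnnorm_mul_brace_le p s m) u s
  exact ⟨G, hG, fun R h0 h1 j => hb ⟨R, h0, h1⟩ j⟩

/-- A positive finite limit c rules out the products 0 · ∞, so `f` may have limsup 0 or ∞. -/
theorem limsup_mul_le_of_tendsto {a : ℝ → ℝ} {c : ℝ} (hc : 0 < c) {ρ : ℝ}
    (ha : Tendsto a (𝓝[<] ρ) (𝓝 c)) (f : ℝ → ℝ≥0∞) :
    limsup (fun R => ENNReal.ofReal (a R) * f R) (𝓝[<] ρ) ≤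
      ENNReal.ofReal c * limsup f (𝓝[<] ρ) := by
  have h : limsup (fun R => ENNReal.ofReal (a R)) (𝓝[<] ρ) = ENNReal.ofReal c :=
    (ENNReal.tendsto_ofReal ha).limsup_eq
  rw [← h]
  refine ENNReal.limsup_mul_le' (Or.inl ?_) (Or.inl ?_)
  · rw [h]
    simpa using hc
  · rw [h]
    exact ENNReal.ofReal_ne_top

theorem eventually_pos_lt (hρ : 0 < ρ) : ∀ᶠ R in 𝓝[<] ρ, 0 < R ∧ R < ρ :=
  Ioo_mem_nhdsLT hρ

theorem tendsto_pow_mul_inv_pow (hρ : 0 < ρ) (j s : ℕ) (b : ℝ) :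
    Tendsto (fun R : ℝ => R ^ j * (R ^ s)⁻¹ * b) (𝓝[<] ρ) (𝓝 (ρ ^ j * (ρ ^ s)⁻¹ * b)) := by
  have h : ContinuousAt (fun R : ℝ => R ^ j * (R ^ s)⁻¹ * b) ρ := by
    have : ρ ^ s ≠ 0 := (pow_pos hρ s).ne'
    fun_prop (disch := assumption)
  exact h.tendsto.mono_left nhdsWithin_le_nhds

theorem brace_pos (s m : ℕ) : (0 : ℝ) < brace p s m :=
  zero_lt_one.trans_le (by exact_mod_cast one_le_brace p s m)

theorem boundaryNorm_wronskian_coeff_le (hp : ‖(p : Ω)‖ = (p : ℝ)⁻¹) {n : ℕ}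
    {u : Fin n → meroField Ω 1} (hu : IsUnit (wronskian u)) {s : ℕ} {G : Fin n → meroField Ω 1}
    (hG : (fun j => dividedIterate (D Ω 1) s (u j)) = Matrix.vecMul G (wronskian u)) (j : Fin n) :
    boundaryNorm (G j) ≤ (brace p s (n - 1) : ℝ≥0∞) := by
  obtain ⟨G', hG', hb⟩ := exists_dividedIterate_D_eq_sum hp u s
  -- Invertibility of the Wronskian makes the coefficients unique, so the given ones inherit the
  -- bounds of the constructed ones.
  have e : G = G' := by
    refine Matrix.vecMul_injective_of_isUnit hu (hG.symm.trans (funext fun c => ?_))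
    exact hG' c
  subst e
  -- The radius factor `R ^ j * (R ^ s)⁻¹` tends to 1 as R → 1.
  have hlim := ENNReal.tendsto_ofReal
    (tendsto_pow_mul_inv_pow one_pos (j : ℕ) s (brace p s (n - 1)))
  rw [one_pow, one_pow, inv_one, one_mul, one_mul, ENNReal.ofReal_coe_nnreal] at hlim
  rw [← hlim.limsup_eq]
  refine limsup_le_limsup ?_
  filter_upwards [eventually_pos_lt one_pos] with R hR
  exact ENNReal.ofReal_le_ofReal (hb R hR.1 hR.2 j)

theorem iterMatrix_mul {n : ℕ} {A Y : Matrix (Fin n) (Fin n) (meroField Ω ρ)}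
    (hY : Y.map (D Ω ρ) = A * Y) (s : ℕ) (i c : Fin n) :
    (iterMatrix A s * Y) i c = dividedIterate (D Ω ρ) s (Y i c) :=
  (iterMatrix_spec (A := A) (y := fun i => Y i c)
    (fun i => congrFun (congrFun hY i) c) s i).symm

theorem exists_iterMatrix_row_eq_sum (hp : ‖(p : Ω)‖ = (p : ℝ)⁻¹) {n : ℕ}
    {A Y : Matrix (Fin n) (Fin n) (meroField Ω ρ)} (hu : IsUnit Y)
    (hY : Y.map (D Ω ρ) = A * Y) (s : ℕ) (i : Fin n) :
    ∃ G : Fin n → meroField Ω ρ,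
      (∀ c, iterMatrix A s i c =
        ∑ k : Fin n, G k * ((((k : ℕ).factorial : ℕ) : meroField Ω ρ) • iterMatrix A k) i c) ∧
      ∀ R, 0 < R → R < ρ → ∀ j,
        fracRadialNorm R (G j) ≤ R ^ (j : ℕ) * (R ^ s)⁻¹ * brace p s (n - 1) := by
  obtain ⟨G, hG, hb⟩ := exists_dividedIterate_D_eq_sum hp (Y i) s
  refine ⟨G, fun c => ?_, hb⟩
  -- The identity is checked after multiplication by Y, where both sides are derivatives of row i of
  -- Y.
  have h : Matrix.vecMul (iterMatrix A s i) Y = Matrix.vecMul (fun c =>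
      ∑ k : Fin n, G k * ((((k : ℕ).factorial : ℕ) : meroField Ω ρ) • iterMatrix A k) i c) Y := by
    funext c
    refine (iterMatrix_mul hY s i c).trans ((hG c).trans ?_)
    simp only [Matrix.vecMul, dotProduct, Finset.sum_mul]
    rw [Finset.sum_comm]
    refine Finset.sum_congr rfl fun k _ => ?_
    rw [iterate_eq_factorial_mul_dividedIterate, ← iterMatrix_mul hY, Matrix.mul_apply,
      Finset.mul_sum, Finset.mul_sum]
    refine Finset.sum_congr rfl fun l _ => ?_
    rw [Matrix.smul_apply, smul_eq_mul]
    ring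
  exact congrFun (Matrix.vecMul_injective_of_isUnit hu h) c

theorem matrixNorm_iterMatrix_le (hp : ‖(p : Ω)‖ = (p : ℝ)⁻¹) (hρ : 0 < ρ) {n : ℕ}
    {A Y : Matrix (Fin n) (Fin n) (meroField Ω ρ)} (hu : IsUnit Y)
    (hY : Y.map (D Ω ρ) = A * Y) (s : ℕ) :
    matrixNorm (iterMatrix A s) ≤
      ENNReal.ofReal ((ρ ^ s)⁻¹) * (brace p s (n - 1) : ℝ≥0∞) *
        ⨆ i : Fin n, ENNReal.ofReal (ρ ^ (i : ℕ)) *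
          matrixNorm ((((i : ℕ).factorial : ℕ) : meroField Ω ρ) • iterMatrix A i) := by
  refine iSup_le fun i => iSup_le fun c => ?_
  obtain ⟨G, hG, hb⟩ := exists_iterMatrix_row_eq_sum hp hu hY s i
  set M : Fin n → meroField Ω ρ :=
    fun k => ((((k : ℕ).factorial : ℕ) : meroField Ω ρ) • iterMatrix A k) i c
  have h1 : boundaryNorm (iterMatrix A s i c) ≤ limsup (fun R => Finset.univ.sup fun k : Fin n =>
      ENNReal.ofReal (R ^ (k : ℕ) * (R ^ s)⁻¹ * brace p s (n - 1)) *
        ENNReal.ofReal (fracRadialNorm R (M k))) (𝓝[<] ρ) := by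
    refine limsup_le_limsup ?_
    filter_upwards [eventually_pos_lt hρ] with R hR
    rw [hG c]
    have hR0 := hR.1
    have : Nonempty (Fin n) := ⟨i⟩
    obtain ⟨k, -, hk⟩ := (isNonarchimedean_fracAbs (Ω := Ω) hR.1 hR.2).finset_image_add_of_nonempty
      (fun k => G k * M k) Finset.univ_nonempty
    refine le_trans ?_ (Finset.le_sup (Finset.mem_univ k))
    rw [← ENNReal.ofReal_mul (by have := brace_pos (p := p) s (n - 1); positivity)]
    refine ENNReal.ofReal_le_ofReal (hk.trans ?_)
    rw [fracAbs_apply, fracRadialNorm_mul hR.1 hR.2]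
    exact mul_le_mul_of_nonneg_right (hb R hR.1 hR.2 k) (fracRadialNorm_nonneg _)
  refine h1.trans ?_
  -- The limsup commutes with a finite maximum, so each k is treated separately.
  rw [limsup_finset_sup]
  refine Finset.sup_le fun k _ => ?_
  have hpos : 0 < ρ ^ (k : ℕ) * (ρ ^ s)⁻¹ * (brace p s (n - 1) : ℝ) := by
    have := brace_pos (p := p) s (n - 1)
    positivity
  refine (limsup_mul_le_of_tendsto hpos (tendsto_pow_mul_inv_pow hρ _ _ _) _).trans ?_
  have hM : boundaryNorm (M k) ≤
      matrixNorm ((((k : ℕ).factorial : ℕ) : meroField Ω ρ) • iterMatrix A k) :=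
    le_iSup₂_of_le (f := fun i c => boundaryNorm
      (((((k : ℕ).factorial : ℕ) : meroField Ω ρ) • iterMatrix A k) i c)) i c le_rfl
  calc _ = ENNReal.ofReal ((ρ ^ s)⁻¹) * (brace p s (n - 1) : ℝ≥0∞) *
        (ENNReal.ofReal (ρ ^ (k : ℕ)) * boundaryNorm (M k)) := by
        rw [ENNReal.ofReal_mul (by positivity), ENNReal.ofReal_mul (by positivity),
          ENNReal.ofReal_coe_nnreal, boundaryNorm]
        ring
    _ ≤ _ := mul_le_mul_right ((mul_le_mul_right hM _).trans (le_iSup (fun k : Fin n =>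
        ENNReal.ofReal (ρ ^ (k : ℕ)) * matrixNorm
          ((((k : ℕ).factorial : ℕ) : meroField Ω ρ) • iterMatrix A k)) k)) _

end Main

end
end DworkRobba

theorem mainTheorem7 (p : ℕ) [Fact p.Prime] (Ω : Type*) [NormedField Ω] [IsUltrametricDist Ω]
    [CharZero Ω] (hp : ‖(p : Ω)‖ = (p : ℝ)⁻¹) :
    -- Dwork–Robba, on the open unit disk
    (∀ (n : ℕ) (u : Fin n → DworkRobba.meroField Ω 1), IsUnit (DworkRobba.wronskian u) →
      ∀ s : ℕ,
        (∃! G : Fin n → DworkRobba.meroField Ω 1,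
          (fun j => ((s.factorial : ℕ) : DworkRobba.meroField Ω 1)⁻¹ *
            (DworkRobba.D Ω 1)^[s] (u j)) = Matrix.vecMul G (DworkRobba.wronskian u)) ∧
        ∀ G : Fin n → DworkRobba.meroField Ω 1,
          (fun j => ((s.factorial : ℕ) : DworkRobba.meroField Ω 1)⁻¹ *
            (DworkRobba.D Ω 1)^[s] (u j)) = Matrix.vecMul G (DworkRobba.wronskian u) →
          ∀ j, DworkRobba.boundaryNorm (G j) ≤ (DworkRobba.brace p s (n - 1) : ENNReal)) ∧
    -- differential systems on the open unit disk
    (∀ (n : ℕ) (A Y : Matrix (Fin n) (Fin n) (DworkRobba.meroField Ω 1)), IsUnit Y →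
      Y.map (DworkRobba.D Ω 1) = A * Y →
      ∀ s : ℕ,
        DworkRobba.matrixNorm (DworkRobba.iterMatrix A s) ≤
          (DworkRobba.brace p s (n - 1) : ENNReal) *
            ⨆ i : Fin n, DworkRobba.matrixNorm
              ((((i : ℕ).factorial : ℕ) : DworkRobba.meroField Ω 1) •
                DworkRobba.iterMatrix A i)) ∧
    -- differential systems on an open disk of radius `ρ`
    (∀ (ρ : ℝ), 0 < ρ →
      ∀ (n : ℕ) (A Y : Matrix (Fin n) (Fin n) (DworkRobba.meroField Ω ρ)), IsUnit Y →
      Y.map (DworkRobba.D Ω ρ) = A * Y →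
      ∀ s : ℕ,
        DworkRobba.matrixNorm (DworkRobba.iterMatrix A s) ≤
          ENNReal.ofReal ((ρ ^ s)⁻¹) * (DworkRobba.brace p s (n - 1) : ENNReal) *
            ⨆ i : Fin n, ENNReal.ofReal (ρ ^ (i : ℕ)) * DworkRobba.matrixNorm
              ((((i : ℕ).factorial : ℕ) : DworkRobba.meroField Ω ρ) •
                DworkRobba.iterMatrix A i)) := by
  refine ⟨fun n u hu s => ⟨?_, fun G hG => DworkRobba.boundaryNorm_wronskian_coeff_le hp hu hG⟩,
    fun n A Y hu hY s => ?_,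
    fun ρ hρ n A Y hu hY s => DworkRobba.matrixNorm_iterMatrix_le hp hρ hu hY s⟩
  · obtain ⟨G, hG, -⟩ := DworkRobba.exists_dividedIterate_D_eq_sum hp u s
    have h : (fun j => DworkRobba.dividedIterate (DworkRobba.D Ω 1) s (u j)) =
        Matrix.vecMul G (DworkRobba.wronskian u) := funext hG
    exact ⟨G, h, fun G' hG' => Matrix.vecMul_injective_of_isUnit hu (hG'.symm.trans h)⟩
  -- The unit disk is the case ρ = 1, where all powers of ρ disappear.
  · simpa using DworkRobba.matrixNorm_iterMatrix_le hp one_pos hu hY s
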